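/- Let $n\ge 1$, and let $(\xi,J)=(\xi_t,J_t)_{t\ge 0}$ be a Markov additive process (MAP) with state space $\mathbb{R}\times\{1,\dots,n\}$, lifetime $\zeta\in(0,\infty]$ and laws $\mathbb{P}^{x,i}$ (under which it starts at $(x,i)$). That is, $(\xi,J)$ is a càdlàg strong Markov process, adapted to a filtration $(\mathcal{F}_t)_{t\ge0}$ satisfying the usual hypotheses, such that for all $s,t\ge 0$ and all bounded measurable $f$ (functions being extended by $0$ to the cemetery state) $$\mathbb{E}^{x,i}\bigl[f(\xi_{t+s}-\xi_t,J_{t+s})\mathbf{1}_{\{\zeta>t\}}\bigm|\mathcal{F}_t\bigr]=\mathbb{E}^{0,J_t}\bigl[f(\xi_s,J_s)\bigr]\mathbf{1}_{\{\zeta>t\}}.$$ Its characteristic matrix exponent is the function $\Psi:\mathbb{R}\to\mathbb{C}^{n\times n}$ with $$\bigl(e^{t\Psi(\theta)}\bigr)_{i,j}=\mathbb{E}^{0,i}\bigl[e^{\mathrm{i}\theta\xi_t};\,J_t=j\bigr]\qquad(t\ge 0,\ \theta\in\mathbb{R},\ 1\le i,j\le n).$$ Its Lévy component $\xi^{(i)}$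 in phase $i$ is the Lévy process as which $\xi$ evolves while $J$ is in state $i$: for every $t\ge0$, the law of $(\xi_s)_{s\le t}$ under $\mathbb{P}^{0,i}$, conditionally on the process being alive at time $t$ and $J$ having stayed in $i$ throughout $[0,t]$, is the law of $(\xi^{(i)}_s)_{s\le t}$. A Lévy process $Y$ has lattice support if there is an $r>0$ such that $\mathbb{P}(Y_t\in r\mathbb{Z})=1$ for all $t\ge0$ (in particular the zero process has lattice support). Suppose that $(\xi,J)$ is unkilled (that is, $\zeta=\infty$ almost surely), that $J$ is irreducible (for all $i,j$ there is a $t\ge0$ with $\mathbb{P}^{0,i}(J_t=j)>0$), and that none of the Lévy components $\xi^{(1)},\dots,\xi^{(n)}$ has lattice support. Then $\Psi(\theta)$ is invertible, i.e. $\Psi(\theta)\in \mathrm{GL}_n(\mathbb{C})$, for every $\theta\in\mathbb{R}\setminus\{0\}$. -/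

import Mathlib

open MeasureTheory ProbabilityTheory Filter Topology
open scoped NNReal ENNReal

/-- On the time interval `[0, ζ)` the path `x` is right-continuous and has left limits. -/
def IsCadlagBefore {E : Type*} [TopologicalSpace E] (x : ℝ≥0 → E) (ζ : WithTop ℝ≥0) : Prop :=
  ∀ t : ℝ≥0, (t : WithTop ℝ≥0) < ζ →
    ContinuousWithinAt x (Set.Ici t) t ∧ ∃ l : E, Tendsto x (𝓝[<] t) (𝓝 l)

/-- `Y` is an (unkilled, real-valued) Lévy process under `μ`: it starts at `0`, has independent
and stationary increments, and almost all of its paths are càdlàg. -/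
structure IsLevyProcess {Ω : Type*} [MeasurableSpace Ω] (Y : ℝ≥0 → Ω → ℝ) (μ : Measure Ω) :
    Prop where
  isProbabilityMeasure : IsProbabilityMeasure μ
  measurable : ∀ t, Measurable (Y t)
  start : ∀ᵐ ω ∂μ, Y 0 ω = 0
  indep_increments : HasIndepIncrements Y μ
  stationary_increments : ∀ s t : ℝ≥0,
    IdentDistrib (fun ω => Y (s + t) ω - Y s ω) (Y t) μ μ
  cadlag : ∀ᵐ ω ∂μ, IsCadlagBefore (fun t => Y t ω) ⊤

/-- The process `Y` has lattice support under `μ`: there is one lattice `r ℤ`, `r > 0`, which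
contains `Y t` almost surely, for every time `t`. (The zero process has lattice support.) -/
def HasLatticeSupport {Ω : Type*} [MeasurableSpace Ω] (Y : ℝ≥0 → Ω → ℝ) (μ : Measure Ω) : Prop :=
  ∃ r : ℝ, 0 < r ∧ ∀ t : ℝ≥0, ∀ᵐ ω ∂μ, ∃ k : ℤ, Y t ω = r * k

/-- The raw data of a killed process `(ξ, J)` on `ℝ × {1, …, n}`: the two coordinate processes,
the lifetime `ζ`, the measures `P x i` and a filtration. The values of `ξ t` and `J t` at times
`t ≥ ζ` play no role: below the process is only ever looked at on the event `{t < ζ}`. -/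
structure ModulatedProcess (n : ℕ) (Ω : Type*) [mΩ : MeasurableSpace Ω] where
  /-- the ordinator -/
  ξ : ℝ≥0 → Ω → ℝ
  /-- the modulator -/
  J : ℝ≥0 → Ω → Fin n
  /-- the lifetime -/
  ζ : Ω → WithTop ℝ≥0
  /-- `P x i` is the law of the process started at `(x, i)` -/
  P : ℝ → Fin n → Measure Ω
  /-- the filtration -/
  𝓕 : Filtration ℝ≥0 mΩ

namespace ModulatedProcess

variable {n : ℕ} {Ω : Type*} [mΩ : MeasurableSpace Ω]

/-- The event `{t < ζ}` that the process is still alive at time `t`. -/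
def alive (X : ModulatedProcess n Ω) (t : ℝ≥0) : Set Ω :=
  {ω | (t : WithTop ℝ≥0) < X.ζ ω}

/-- `E^{x,i}[f(ξ_s, J_s)]`, where a function vanishes at the cemetery. -/
noncomputable def expect (X : ModulatedProcess n Ω) (x : ℝ) (i : Fin n) (s : ℝ≥0)
    (f : ℝ × Fin n → ℝ) : ℝ :=
  ∫ ω, (X.alive s).indicator (fun ω => f (X.ξ s ω, X.J s ω)) ω ∂(X.P x i)

/-- `(ξ, J)` is a Markov additive process with `n` phases and lifetime `ζ ∈ (0, ∞]`: a càdlàg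
strong Markov process, adapted to a filtration that satisfies the usual hypotheses, with the
Markov additive property. Functions `f` vanish at the cemetery. -/
structure IsMAP (X : ModulatedProcess n Ω) : Prop where
  isProbabilityMeasure : ∀ x i, IsProbabilityMeasure (X.P x i)
  start : ∀ x i, ∀ᵐ ω ∂(X.P x i), X.ξ 0 ω = x ∧ X.J 0 ω = i ∧ 0 < X.ζ ω
  /-- The filtration is right-continuous. -/
  rightContinuous : X.𝓕.IsRightContinuous
  /-- The filtration is complete: it contains the sets that are null for all the laws. -/
  complete : ∀ N : Set Ω, (∀ x i, X.P x i N = 0) → MeasurableSet[X.𝓕 0] N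
  adapted_ordinator : ∀ t, Measurable[X.𝓕 t] (X.ξ t)
  adapted_modulator : ∀ t, Measurable[X.𝓕 t] (X.J t)
  isStoppingTime_lifetime : IsStoppingTime X.𝓕 X.ζ
  cadlag : ∀ x i, ∀ᵐ ω ∂(X.P x i),
    IsCadlagBefore (fun t => X.ξ t ω) (X.ζ ω) ∧ IsCadlagBefore (fun t => X.J t ω) (X.ζ ω)
  /-- Strong Markov property:
  `E^{x,i}[f(ξ_{τ+s}, J_{τ+s}); τ + s < ζ | 𝓕_τ] = E^{ξ_τ, J_τ}[f(ξ_s, J_s)]` on `{τ < ζ}`. -/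
  strongMarkov : ∀ (x : ℝ) (i : Fin n) (τ : Ω → WithTop ℝ≥0) (hτ : IsStoppingTime X.𝓕 τ)
    (s : ℝ≥0) (f : ℝ × Fin n → ℝ), Measurable f → (∃ C, ∀ z, |f z| ≤ C) →
    condExp hτ.measurableSpace (X.P x i)
      ({ω | τ ω + (s : WithTop ℝ≥0) < X.ζ ω}.indicator fun ω =>
        f (X.ξ ((τ ω).untopD 0 + s) ω, X.J ((τ ω).untopD 0 + s) ω))
    =ᵐ[X.P x i]
      {ω | τ ω < X.ζ ω}.indicator fun ω =>
        X.expect (X.ξ ((τ ω).untopD 0) ω) (X.J ((τ ω).untopD 0) ω) s f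
  /-- Markov additive property:
  `E^{x,i}[f(ξ_{t+s} - ξ_t, J_{t+s}) 1_{t<ζ} | 𝓕_t] = E^{0, J_t}[f(ξ_s, J_s)] 1_{t<ζ}`. -/
  additive : ∀ (x : ℝ) (i : Fin n) (s t : ℝ≥0)
    (f : ℝ × Fin n → ℝ), Measurable f → (∃ C, ∀ z, |f z| ≤ C) →
    condExp (X.𝓕 t) (X.P x i)
      ((X.alive (t + s)).indicator fun ω => f (X.ξ (t + s) ω - X.ξ t ω, X.J (t + s) ω))
    =ᵐ[X.P x i]
      (X.alive t).indicator fun ω => X.expect 0 (X.J t ω) s f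

/-- The process is unkilled: its lifetime is almost surely infinite. -/
def IsUnkilled (X : ModulatedProcess n Ω) : Prop :=
  ∀ x i, ∀ᵐ ω ∂(X.P x i), X.ζ ω = ⊤

/-- The modulator is irreducible: any state can be reached from any state. -/
def IsIrreducible (X : ModulatedProcess n Ω) : Prop :=
  ∀ i j : Fin n, ∃ t : ℝ≥0, 0 < X.P 0 i (X.alive t ∩ {ω | X.J t ω = j})

/-- The matrix with entries `E^{0,i}[exp(i θ ξ_t); J_t = j]`. -/
noncomputable def charMatrix (X : ModulatedProcess n Ω) (t : ℝ≥0) (θ : ℝ) :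
    Matrix (Fin n) (Fin n) ℂ :=
  Matrix.of fun i j => ∫ ω in X.alive t ∩ {ω | X.J t ω = j},
    Complex.exp (Complex.I * θ * X.ξ t ω) ∂(X.P 0 i)

/-- `Ψ` is the characteristic matrix exponent of `(ξ, J)`:
`(e^{t Ψ(θ)})_{i,j} = E^{0,i}[exp(i θ ξ_t); J_t = j]` for all real `θ` and all `t ≥ 0`. -/
def IsCharExponent (X : ModulatedProcess n Ω) (Ψ : ℝ → Matrix (Fin n) (Fin n) ℂ) : Prop :=
  ∀ (θ : ℝ) (t : ℝ≥0), NormedSpace.exp ((t : ℂ) • Ψ θ) = X.charMatrix t θ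

/-- The event that the process is alive at time `t` and that the modulator has been in state `i`
throughout `[0, t]`; under `P 0 i` this says that neither the first jump of `J` nor the killing
has occurred by time `t`. -/
def staysIn (X : ModulatedProcess n Ω) (i : Fin n) (t : ℝ≥0) : Set Ω :=
  X.alive t ∩ {ω | ∀ s ≤ t, X.J s ω = i}

/-- `Y`, under `μ`, is the Lévy component of `(ξ, J)` in phase `i`: it is a Lévy process, and `ξ`
evolves as `Y` while the modulator stays in `i`. That is, for every `t`, given that `J`, started
at `i`, has not left `i` by time `t`, the path `(ξ_s)_{s ≤ t}` has the law of `(Y_s)_{s ≤ t}`. -/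
structure IsLevyComponent (X : ModulatedProcess n Ω) (i : Fin n) {Ω' : Type*} [MeasurableSpace Ω']
    (Y : ℝ≥0 → Ω' → ℝ) (μ : Measure Ω') : Prop where
  isLevyProcess : IsLevyProcess Y μ
  identDistrib : ∀ t : ℝ≥0,
    IdentDistrib (fun ω (s : Set.Iic t) => X.ξ s ω) (fun ω' (s : Set.Iic t) => Y s ω')
      (ProbabilityTheory.cond (X.P 0 i) (X.staysIn i t)) μ

end ModulatedProcess

/-! A maximum principle. If `Ψ θ` is singular, take `v ≠ 0` in its kernel; then `exp (t Ψ θ)` fixes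
`v`, so `exp (i θ ξ_t) v_{J_t}` has mean `v i` under `P 0 i` for every `t`. Start in a phase `i`
where `‖v i‖` is maximal: the variable is bounded by the modulus of its own mean, so it is almost
surely equal to `v i` (`ae_eq_of_integral_eq_of_norm_le`). On `{J_t = i}` the nonzero factor `v i`
cancels, leaving `exp (i θ ξ_t) = 1`. This confines the Lévy component in phase `i` to a lattice
(`IsLevyComponent.hasLatticeSupport`), a contradiction. -/

/-- A bounded random variable whose mean attains the bound is almost surely constant. -/
theorem ae_eq_of_integral_eq_of_norm_le {Ω : Type*} [MeasurableSpace Ω] {P : Measure Ω}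
    [IsProbabilityMeasure P] {Z : Ω → ℂ} {c : ℂ}
    (hle : ∀ᵐ ω ∂P, ‖Z ω‖ ≤ ‖c‖) (hint : ∫ ω, Z ω ∂P = c) : ∀ᵐ ω ∂P, Z ω = c := by
  -- Strict convexity of the disc: a nonconstant variable has its mean strictly inside.
  have h := ae_eq_const_or_norm_average_lt_of_norm_le_const (C := ‖c‖) hle
  rw [average_eq_integral, hint] at h
  exact h.resolve_right (lt_irrefl _)

/-- The exponential of a matrix fixes the vectors of its kernel. -/
theorem Matrix.exp_mulVec_of_mulVec_eq_zero {m : Type*} [Fintype m] [DecidableEq m]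
    {A : Matrix m m ℂ} {v : m → ℂ} (h : A.mulVec v = 0) :
    (NormedSpace.exp A).mulVec v = v := by
  -- The norm serves only to make the exponential series converge; its topology is the entrywise
  -- one.
  let _ : NormedRing (Matrix m m ℂ) := Matrix.linftyOpNormedRing
  let _ : NormedAlgebra ℂ (Matrix m m ℂ) := Matrix.linftyOpNormedAlgebra
  have hs := NormedSpace.exp_series_hasSum_exp' (𝕂 := ℂ) A
  let L : Matrix m m ℂ →+ (m → ℂ) :=
    { toFun := fun B => B.mulVec v
      map_zero' := Matrix.zero_mulVec v
      map_add' := fun B C => Matrix.add_mulVec B C v }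
  have hL : Continuous L := continuous_id.matrix_mulVec continuous_const
  have h1 := hs.map L hL
  refine h1.unique ?_
  have h0 : (fun k : ℕ => L ((k.factorial⁻¹ : ℂ) • A ^ k)) 0 = v := by simp [L]
  suffices ∀ k : ℕ, k ≠ 0 → L ((k.factorial⁻¹ : ℂ) • A ^ k) = 0 from
    by simpa only [h0, Function.comp_def] using hasSum_single 0 this
  intro k hk
  obtain ⟨k, rfl⟩ := Nat.exists_eq_succ_of_ne_zero hk
  simp [L, Matrix.smul_mulVec, pow_succ, ← Matrix.mulVec_mulVec, h]

/-- If `exp (i θ x) = 1` with `θ ≠ 0`, then `x` lies in the lattice `(2 π / |θ|) ℤ`. -/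
theorem exists_int_of_exp_I_mul_eq_one {θ x : ℝ} (hθ : θ ≠ 0)
    (h : Complex.exp (Complex.I * θ * x) = 1) : ∃ k : ℤ, x = 2 * Real.pi / |θ| * k := by
  obtain ⟨k, hk⟩ := Complex.exp_eq_one_iff.1 h
  have hx : θ * x = k * (2 * Real.pi) := by
    have : ((θ * x : ℝ) : ℂ) = ((k * (2 * Real.pi) : ℝ) : ℂ) := by
      push_cast
      refine mul_left_cancel₀ Complex.I_ne_zero ?_
      linear_combination hk
    exact_mod_cast this
  rcases abs_choice θ with ha | ha
  · refine ⟨k, ?_⟩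
    rw [ha]
    field_simp
    linarith
  · refine ⟨-k, ?_⟩
    rw [ha]
    push_cast
    field_simp
    linarith

namespace ModulatedProcess

variable {n : ℕ} {Ω : Type*} [mΩ : MeasurableSpace Ω]

theorem IsMAP.measurable_ordinator {X : ModulatedProcess n Ω} (hX : X.IsMAP) (t : ℝ≥0) :
    Measurable (X.ξ t) :=
  (hX.adapted_ordinator t).mono (X.𝓕.le t) le_rfl

theorem IsMAP.measurable_modulator {X : ModulatedProcess n Ω} (hX : X.IsMAP) (t : ℝ≥0) :
    Measurable (X.J t) :=
  (hX.adapted_modulator t).mono (X.𝓕.le t) le_rfl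

/-- `ω ↦ exp (i θ ξ_t) v_{J_t}` -/
noncomputable def harmonicValue (X : ModulatedProcess n Ω) (θ : ℝ) (v : Fin n → ℂ) (t : ℝ≥0)
    (ω : Ω) : ℂ :=
  Complex.exp (Complex.I * θ * X.ξ t ω) * v (X.J t ω)

theorem norm_harmonicValue (X : ModulatedProcess n Ω) (θ : ℝ) (v : Fin n → ℂ) (t : ℝ≥0) (ω : Ω) :
    ‖X.harmonicValue θ v t ω‖ = ‖v (X.J t ω)‖ := by
  have : Complex.I * θ * X.ξ t ω = ((θ * X.ξ t ω : ℝ) : ℂ) * Complex.I := by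
    push_cast; ring
  rw [harmonicValue, norm_mul, this, Complex.norm_exp_ofReal_mul_I, one_mul]

theorem IsMAP.measurable_harmonicValue {X : ModulatedProcess n Ω} (hX : X.IsMAP) (θ : ℝ)
    (v : Fin n → ℂ) (t : ℝ≥0) : Measurable (X.harmonicValue θ v t) := by
  have h1 := hX.measurable_ordinator t
  have h2 : Measurable fun ω => v (X.J t ω) :=
    (measurable_of_countable v).comp (hX.measurable_modulator t)
  exact (by fun_prop : Measurable fun ω => Complex.exp (Complex.I * θ * X.ξ t ω)).mul h2

theorem IsMAP.integrable_harmonicValue {X : ModulatedProcess n Ω} (hX : X.IsMAP) (θ : ℝ)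
    (v : Fin n → ℂ) (t : ℝ≥0) (x : ℝ) (i : Fin n) :
    Integrable (X.harmonicValue θ v t) (X.P x i) := by
  have := hX.isProbabilityMeasure x i
  refine Integrable.of_bound (hX.measurable_harmonicValue θ v t).aestronglyMeasurable
    (∑ j, ‖v j‖) (ae_of_all _ fun ω => ?_)
  rw [norm_harmonicValue]
  exact Finset.single_le_sum (f := fun j => ‖v j‖) (fun j _ => norm_nonneg _) (Finset.mem_univ _)

/-- For an unkilled process, `(charMatrix t θ) v` is the vector of the means of
`exp (i θ ξ_t) v_{J_t}`. -/
theorem IsMAP.integral_harmonicValue {X : ModulatedProcess n Ω} (hX : X.IsMAP)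
    (hunkilled : X.IsUnkilled) (θ : ℝ) (v : Fin n → ℂ) (t : ℝ≥0) (i : Fin n) :
    ∫ ω, X.harmonicValue θ v t ω ∂(X.P 0 i) = (X.charMatrix t θ).mulVec v i := by
  have hms (j : Fin n) : MeasurableSet {ω | X.J t ω = j} :=
    hX.measurable_modulator t (measurableSet_singleton j)
  have hint := hX.integrable_harmonicValue θ v t 0 i
  have hunion : (⋃ j, {ω | X.J t ω = j}) = Set.univ := by
    ext ω; simp
  rw [← setIntegral_univ, ← hunion, integral_iUnion_fintype hms ?_ fun j => hint.integrableOn]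
  · simp only [Matrix.mulVec, dotProduct, charMatrix, Matrix.of_apply]
    refine Finset.sum_congr rfl fun j _ => ?_
    -- Without killing, `alive t` has full measure and can be dropped from the event.
    have hae : (X.alive t ∩ {ω | X.J t ω = j} : Set Ω) =ᵐ[X.P 0 i] {ω | X.J t ω = j} := by
      filter_upwards [hunkilled 0 i] with ω hω
      have : ω ∈ X.alive t := by
        simpa only [alive, Set.mem_ofPred_eq, hω] using WithTop.coe_lt_top t
      exact propext ⟨fun h => h.2, fun h => ⟨this, h⟩⟩
    rw [setIntegral_congr_set hae, ← integral_mul_const]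
    refine setIntegral_congr_fun (hms j) fun ω hω => ?_
    simp only [harmonicValue]
    rw [show X.J t ω = j from hω]
  · intro j k hjk
    refine Set.disjoint_left.2 fun ω h1 h2 => hjk ?_
    exact (show X.J t ω = j from h1).symm.trans h2

/-- If `exp (i θ ξ_t) = 1` almost surely on `{J_t = i}` for every `t`, then the Lévy component in
phase `i` has lattice support. -/
theorem IsLevyComponent.hasLatticeSupport {X : ModulatedProcess n Ω} {i : Fin n}
    {Ω' : Type*} [MeasurableSpace Ω'] {Y : ℝ≥0 → Ω' → ℝ} {μ : Measure Ω'}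
    (hY : X.IsLevyComponent i Y μ) {θ : ℝ} (hθ : θ ≠ 0)
    (hphase : ∀ t, ∀ᵐ ω ∂(X.P 0 i), X.J t ω = i → Complex.exp (Complex.I * θ * X.ξ t ω) = 1)
    (hJ : ∀ t, Measurable (X.J t)) : HasLatticeSupport Y μ := by
  -- The spacing depends on `θ` alone, so one lattice serves all times.
  refine ⟨2 * Real.pi / |θ|, by positivity, fun t => ?_⟩
  have hcond : ∀ᵐ ω ∂(ProbabilityTheory.cond (X.P 0 i) (X.staysIn i t)),
      Complex.exp (Complex.I * θ * X.ξ t ω) = 1 := by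
    have hJi : MeasurableSet {ω | X.J t ω = i} := hJ t (measurableSet_singleton i)
    have hrestrict : ∀ᵐ ω ∂(X.P 0 i).restrict {ω | X.J t ω = i},
        Complex.exp (Complex.I * θ * X.ξ t ω) = 1 := (ae_restrict_iff' hJi).2 (hphase t)
    -- `cond` is a multiple of the restriction to `staysIn i t`, a subset of `{J_t = i}`; no
    -- measurability of `staysIn i t` is needed.
    exact Measure.ae_smul_measure
      (ae_restrict_of_ae_restrict_of_subset (fun ω hω => hω.2 t le_rfl) hrestrict) _
  -- Only the endpoint of the path on `[0, t]` matters.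
  have hcoord := (hY.identDistrib t).comp
    (measurable_pi_apply (⟨t, Set.mem_Iic.2 le_rfl⟩ : Set.Iic t))
  have hmeas : MeasurableSet {x : ℝ | Complex.exp (Complex.I * θ * x) = 1} :=
    (isClosed_eq (by fun_prop) continuous_const).measurableSet
  filter_upwards [hcoord.ae_snd hmeas hcond] with ω hω
  exact exists_int_of_exp_I_mul_eq_one hθ hω

end ModulatedProcess

theorem mainTheorem10 {n : ℕ} {Ω : Type*} [MeasurableSpace Ω]
    (X : ModulatedProcess n Ω) (hMAP : X.IsMAP) (hunkilled : X.IsUnkilled)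
    (hirr : X.IsIrreducible)
    (Ψ : ℝ → Matrix (Fin n) (Fin n) ℂ) (hΨ : X.IsCharExponent Ψ)
    {Ω' : Fin n → Type*} [∀ i, MeasurableSpace (Ω' i)] (μ : ∀ i, Measure (Ω' i))
    (Y : ∀ i, ℝ≥0 → Ω' i → ℝ) (hY : ∀ i, X.IsLevyComponent i (Y i) (μ i))
    (hlattice : ∀ i, ¬ HasLatticeSupport (Y i) (μ i))
    (θ : ℝ) (hθ : θ ≠ 0) :
    IsUnit (Ψ θ) := by
  rw [Matrix.isUnit_iff_isUnit_det, isUnit_iff_ne_zero]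
  intro hdet
  obtain ⟨v, hv, hker⟩ := Matrix.exists_mulVec_eq_zero_iff.2 hdet
  obtain ⟨k, hk⟩ := Function.ne_iff.1 hv
  obtain ⟨i, -, hi⟩ := Finset.exists_max_image Finset.univ (fun j => ‖v j‖) ⟨k, Finset.mem_univ k⟩
  have hvi : v i ≠ 0 := norm_pos_iff.1 ((norm_pos_iff.2 hk).trans_le (hi k (Finset.mem_univ k)))
  refine hlattice i ((hY i).hasLatticeSupport hθ (fun t => ?_) hMAP.measurable_modulator)
  have := hMAP.isProbabilityMeasure 0 i
  have hmean : ∫ ω, X.harmonicValue θ v t ω ∂(X.P 0 i) = v i := by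
    rw [hMAP.integral_harmonicValue hunkilled, ← hΨ θ t, Matrix.exp_mulVec_of_mulVec_eq_zero]
    rw [Matrix.smul_mulVec, hker, smul_zero]
  filter_upwards [ae_eq_of_integral_eq_of_norm_le
    (ae_of_all _ fun ω => (X.norm_harmonicValue θ v t ω).trans_le (hi _ (Finset.mem_univ _)))
    hmean] with ω hω hJ
  rw [ModulatedProcess.harmonicValue, hJ] at hω
  exact mul_right_cancel₀ hvi (hω.trans (one_mul _).symm)
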